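/- Let $K$ be a commutative field and $L$ a finite separable commutative field extension of $K$. For a $K$-subspace $B\subseteq L$ and $n\ge 1$ let $\langle B^n\rangle$ denote the $K$-subspace of $L$ spanned by all products $b_1b_2\cdots b_n$ with $b_1,\dots,b_n\in B$. (1) Let $B$ be a $K$-subspace of $L$ containing $1$. Then there is an integer $n\ge 1$ such that $\langle B^n\rangle$ is a field, and the smallest such $n$ satisfies $$n\le \frac{2\dim_K L}{\dim_K B},\qquad\text{hence}\qquad n\le\left\lfloor \frac{2\dim_K L}{\dim_K B}\right\rfloor .$$ (2) The last bound is sharp: if $\dim_K L\ge 4$, there is a $K$-subspace $B$ of $L$ containing $1$ for which the smallest $n\ge 1$ such that $\langle B^n\rangle$ is a field equals $\lfloor 2\dim_K L/\dim_K B\rfloor$. More precisely, this equality holds for every $K$-subspace $B$ of $L$ with $\dim_K B=\dim_K L-1$, whether or not it contains $1$ (in particular for every supplementary space of $K$ in $L$). -/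

import Mathlib

open scoped Pointwise

/-- `⟨B^n⟩`: the `K`-subspace of `L` spanned by the set `B^n` of all `n`-fold products
of elements of `B`. -/
def spanPow {K L : Type*} [Field K] [Field L] [Algebra K L]
    (B : Submodule K L) (n : ℕ) : Submodule K L :=
  Submodule.span K ((B : Set L) ^ n)

/-- The subspace `V` of `L` is a field (under the operations of `L`). -/
def IsFieldSubspace {K L : Type*} [Field K] [Field L] [Algebra K L]
    (V : Submodule K L) : Prop :=
  ∃ F : Subfield L, (F : Set L) = (V : Set L)

/-- `n` is the smallest integer `n ≥ 1` such that `⟨B^n⟩` is a field. -/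
def IsFieldExponent {K L : Type*} [Field K] [Field L] [Algebra K L]
    (B : Submodule K L) (n : ℕ) : Prop :=
  IsLeast {m : ℕ | 1 ≤ m ∧ IsFieldSubspace (spanPow B m)} n

section Isoperimetric

open Module

variable {K L : Type*} [Field K] [Field L] [Algebra K L]

/-! The core is Hamidoune's isoperimetric method (`two_mul_finrank_add_finrank_le`): if `B` contains
1 and generates `L`, then multiplying by `B` raises the dimension by at least half of `dim B` until
`L` is filled. Among nonzero `Y` with `Y * B ≠ L`, take one of minimal growth `κ` and, among these,
of least dimension: an atom `A`. Submodularity and trace duality make two multiples of `A` equal or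
disjoint, so `A` is a multiple of a subfield, and `A * B` contains some `A ⊕ bA`; hence `κ ≥ dim A`.
As `κ + dim A = dim (A * B) ≥ dim B`, `2κ ≥ dim B`. Iterating over powers gives the bound, first
when `L = K(B)`, then in general. Hyperplanes give sharpness. -/

theorem spanPow_eq_pow (B : Submodule K L) (n : ℕ) : spanPow B n = B ^ n := by
  rw [spanPow, ← Submodule.span_pow, Submodule.span_eq]

theorem finrank_map_mulLeft {x : L} (hx : x ≠ 0) (A : Submodule K L) :
    finrank K (A.map (LinearMap.mulLeft K x)) = finrank K A :=
  (LinearEquiv.finrank_eq (Submodule.equivMapOfInjective _ (mul_right_injective₀ hx) A)).symm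

theorem map_mulLeft_mul (x : L) (A B : Submodule K L) :
    A.map (LinearMap.mulLeft K x) * B = (A * B).map (LinearMap.mulLeft K x) := by
  have h : ∀ A : Submodule K L,
      A.map (LinearMap.mulLeft K x) = Submodule.span K {x} * A := by
    intro A
    ext y
    simp [Submodule.mem_span_singleton_mul]
  rw [h, h, mul_assoc]

theorem le_mul_of_one_mem {A B : Submodule K L} (hB : (1 : L) ∈ B) : A ≤ A * B :=
  fun a ha => by simpa using Submodule.mul_mem_mul ha hB

variable [FiniteDimensional K L]

/-- Submodularity of `X ↦ dim (X * B)`, since `(X ⊓ Y) * B` lies in both products. -/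
theorem finrank_sup_mul_add_finrank_inf_mul_le (X Y B : Submodule K L) :
    finrank K ↥((X ⊔ Y) * B) + finrank K ↥((X ⊓ Y) * B) ≤
      finrank K ↥(X * B) + finrank K ↥(Y * B) := by
  rw [Submodule.sup_mul, ← Submodule.finrank_sup_add_finrank_inf_eq (X * B) (Y * B)]
  gcongr
  exact Submodule.finrank_mono (le_inf (mul_le_mul_left inf_le_left B)
    (mul_le_mul_left inf_le_right B))

theorem exists_one_mem_finrank_add_one (hL : 4 ≤ finrank K L) :
    ∃ B : Submodule K L, (1 : L) ∈ B ∧ finrank K B + 1 = finrank K L := by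
  have hlt : K ∙ (1 : L) < ⊤ := by
    refine lt_top_iff_ne_top.2 fun h => ?_
    have := finrank_span_singleton (K := K) (one_ne_zero (α := L))
    rw [h, finrank_top] at this
    omega
  obtain ⟨f, hf, hle⟩ := Submodule.exists_le_ker_of_lt_top _ hlt
  exact ⟨LinearMap.ker f, hle (Submodule.mem_span_singleton_self 1),
    Module.Dual.finrank_ker_add_one_of_ne_zero hf⟩

variable [Algebra.IsSeparable K L]

/-- Duality for the trace form: the orthogonal of `X * B`, multiplied by `B`, is orthogonal
to `X`. -/
theorem exists_dual_subspace (X B : Submodule K L) :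
    ∃ Y : Submodule K L, finrank K Y + finrank K ↥(X * B) = finrank K L ∧
      finrank K ↥(Y * B) + finrank K X ≤ finrank K L := by
  have hdim : ∀ W : Submodule K L,
      finrank K ((Algebra.traceForm K L).orthogonal W) + finrank K W = finrank K L := by
    intro W
    rw [LinearMap.BilinForm.finrank_orthogonal (traceForm_nondegenerate K L)]
    exact Nat.sub_add_cancel W.finrank_le
  refine ⟨(Algebra.traceForm K L).orthogonal (X * B), hdim _, ?_⟩
  rw [← hdim X]
  gcongr
  refine Submodule.finrank_mono (Submodule.mul_le.2 fun y hy b hb x hx => ?_)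
  have := hy (x * b) (Submodule.mul_mem_mul hx hb)
  change Algebra.trace K L (x * (y * b)) = 0
  rw [mul_comm y, ← mul_assoc]
  exact this

/-- A linear analogue of Olson's theorem. -/
theorem two_mul_finrank_add_finrank_le {B : Submodule K L} (h1 : (1 : L) ∈ B)
    (hgen : Algebra.adjoin K (B : Set L) = ⊤) {X : Submodule K L} (hX : X ≠ ⊥)
    (hXB : X * B ≠ ⊤) :
    2 * finrank K X + finrank K B ≤ 2 * finrank K ↥(X * B) := by
  have hle : ∀ Y : Submodule K L, finrank K Y ≤ finrank K ↥(Y * B) := fun Y =>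
    Submodule.finrank_mono (le_mul_of_one_mem h1)
  have hpos : ∀ Y : Submodule K L, Y ≠ ⊥ → 0 < finrank K Y := fun Y hY =>
    Nat.pos_of_ne_zero fun h => hY (Submodule.finrank_eq_zero.1 h)
  have htop : ∀ Y : Submodule K L, finrank K Y < finrank K L → Y ≠ ⊤ := by
    rintro Y hY rfl
    simp at hY
  let S : Set (Submodule K L) := {Y | Y ≠ ⊥ ∧ Y * B ≠ ⊤}
  obtain ⟨F, hFS, hF⟩ := (measure fun Y : Submodule K L =>
    finrank K ↥(Y * B) - finrank K Y).wf.has_min S ⟨X, hX, hXB⟩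
  obtain ⟨κ, hκ⟩ := Nat.exists_eq_add_of_le (hle F)
  have hmin : ∀ Y ∈ S, κ + finrank K Y ≤ finrank K ↥(Y * B) := by
    intro Y hY
    have h := hF Y hY
    have := hle Y
    change ¬ finrank K ↥(Y * B) - finrank K Y < finrank K ↥(F * B) - finrank K F at h
    omega
  obtain ⟨A, ⟨hAS, hAκ⟩, hA⟩ := (measure fun Y : Submodule K L => finrank K Y).wf.has_min
    {Y | Y ∈ S ∧ finrank K ↥(Y * B) = κ + finrank K Y} ⟨F, hFS, by omega⟩
  have hatom : ∀ Y ∈ S, finrank K ↥(Y * B) = κ + finrank K Y → finrank K A ≤ finrank K Y :=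
    fun Y hY hYκ => not_lt.1 fun h => hA Y ⟨hY, hYκ⟩ h
  -- The dual of `A` also has growth `κ`, so the atom is no larger than it.
  have hdual : 2 * finrank K A + κ ≤ finrank K L := by
    obtain ⟨Y, hY, hYB⟩ := exists_dual_subspace A B
    have hlt := Submodule.finrank_lt (lt_top_iff_ne_top.2 hAS.2).ne
    have hA0 := hpos A hAS.1
    have hYS : Y ∈ S := by
      refine ⟨?_, htop _ (by omega)⟩
      rintro rfl
      rw [finrank_bot] at hY
      omega
    have h1 := hmin Y hYS
    have h2 := hatom Y hYS (by omega)
    omega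
  -- If `xA ≠ A`, the intersection is smaller than the atom, so its growth exceeds `κ`. By
  -- submodularity the sum then grows by less than `κ`, while `hdual` keeps its product with `B`
  -- proper.
  have hinter : ∀ x : L, x ≠ 0 → A ⊓ A.map (LinearMap.mulLeft K x) ≠ ⊥ →
      A.map (LinearMap.mulLeft K x) = A := by
    intro x hx hne
    set C := A.map (LinearMap.mulLeft K x) with hC
    have hCd : finrank K C = finrank K A := finrank_map_mulLeft hx A
    have hCB : finrank K ↥(C * B) = finrank K ↥(A * B) := by
      rw [hC, map_mulLeft_mul, finrank_map_mulLeft hx]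
    by_contra hCA
    have hsub := finrank_sup_mul_add_finrank_inf_mul_le A C B
    have hadd := Submodule.finrank_sup_add_finrank_inf_eq A C
    have hI0 := hpos _ hne
    have hlt : finrank K ↥(A ⊓ C) < finrank K A := by
      refine Submodule.finrank_lt_finrank_of_lt (lt_of_le_of_ne inf_le_left fun h => hCA ?_)
      exact (Submodule.eq_of_le_of_finrank_eq (inf_eq_left.1 h) hCd.symm).symm
    have hIS : A ⊓ C ∈ S := ⟨hne, fun h => hAS.2
      (top_le_iff.1 (h ▸ mul_le_mul_left inf_le_left B))⟩
    have hI := hmin _ hIS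
    have hI' : finrank K ↥((A ⊓ C) * B) ≠ κ + finrank K ↥(A ⊓ C) := fun h => by
      have := hatom _ hIS h
      omega
    have hS : A ⊔ C ∈ S :=
      ⟨fun h => hAS.1 (le_bot_iff.1 (h ▸ le_sup_left)), htop _ (by omega)⟩
    have := hmin _ hS
    omega
  obtain ⟨a₀, ha₀, ha₀0⟩ := Submodule.exists_mem_ne_zero_of_ne_bot hAS.1
  have hdiv : ∀ a ∈ A, ∀ c ∈ A, c ≠ 0 → ∀ d ∈ A, a * c⁻¹ * d ∈ A := by
    intro a ha c hc hc0 d hd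
    rcases eq_or_ne a 0 with rfl | ha0
    · simp
    have hx : a * c⁻¹ ≠ 0 := mul_ne_zero ha0 (inv_ne_zero hc0)
    rw [← hinter _ hx ?_]
    · exact ⟨d, hd, rfl⟩
    · intro h
      refine ha0 ((Submodule.mem_bot K).1 (h ▸ ⟨ha, c, hc, ?_⟩))
      simp [hc0]
  -- Otherwise `B`, hence all of `L`, stabilizes `A`, forcing `A = L`.
  have hB : ∃ b ∈ B, a₀ * b ∉ A := by
    by_contra! hcon
    refine hAS.2 (top_le_iff.1 fun y _ => ?_)
    have hstab : ∀ z : L, ∀ a ∈ A, z * a ∈ A := by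
      intro z
      have hz : z ∈ Algebra.adjoin K (B : Set L) := hgen ▸ Algebra.mem_top
      induction hz using Algebra.adjoin_induction with
      | mem b hb =>
        intro a ha
        have := hdiv _ (hcon b hb) a₀ ha₀ ha₀0 a ha
        rwa [mul_right_comm a₀, mul_inv_cancel₀ ha₀0, one_mul] at this
      | algebraMap r =>
        intro a ha
        rw [← Algebra.smul_def]
        exact A.smul_mem r ha
      | add u v _ _ hu hv =>
        intro a ha
        rw [add_mul]
        exact A.add_mem (hu a ha) (hv a ha)
      | mul u v _ _ hu hv =>
        intro a ha
        rw [mul_assoc]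
        exact hu _ (hv a ha)
    have := hstab (y * a₀⁻¹) a₀ ha₀
    rw [inv_mul_cancel_right₀ ha₀0] at this
    exact le_mul_of_one_mem h1 this
  obtain ⟨b, hb, hbA⟩ := hB
  have hb0 : b ≠ 0 := by
    rintro rfl
    simp at hbA
  have hdisj : A ⊓ A.map (LinearMap.mulLeft K b) = ⊥ := by
    refine (Submodule.eq_bot_iff _).2 ?_
    rintro _ ⟨h, c, hc, rfl⟩
    by_contra hbc
    have hc0 : c ≠ 0 := by
      rintro rfl
      simp at hbc
    refine hbA ?_
    have := hdiv _ h c hc hc0 a₀ ha₀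
    rwa [LinearMap.mulLeft_apply, mul_inv_cancel_right₀ hc0, mul_comm] at this
  have hsum := Submodule.finrank_sup_add_finrank_inf_eq A (A.map (LinearMap.mulLeft K b))
  rw [hdisj, finrank_bot, finrank_map_mulLeft hb0] at hsum
  have hsup : A ⊔ A.map (LinearMap.mulLeft K b) ≤ A * B := by
    refine sup_le (le_mul_of_one_mem h1) ?_
    rintro _ ⟨a, ha, rfl⟩
    simpa only [LinearMap.mulLeft_apply, mul_comm b] using Submodule.mul_mem_mul ha hb
  have hsup' := Submodule.finrank_mono hsup
  have hBA : finrank K B ≤ finrank K ↥(A * B) := by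
    rw [← finrank_map_mulLeft ha₀0 B]
    refine Submodule.finrank_mono ?_
    rintro _ ⟨c, hc, rfl⟩
    exact Submodule.mul_mem_mul ha₀ hc
  have := hmin X ⟨hX, hXB⟩
  omega

/-- The first power contributes `2 * dim B` to the doubled dimension, each further factor at least
`dim B`. -/
theorem succ_mul_finrank_le_of_pow_ne_top {B : Submodule K L} (h1 : (1 : L) ∈ B)
    (hgen : Algebra.adjoin K (B : Set L) = ⊤) (m : ℕ) (hm : B ^ (m + 1) ≠ ⊤) :
    (m + 2) * finrank K B ≤ 2 * finrank K ↥(B ^ (m + 1)) := by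
  induction m with
  | zero => rw [zero_add 1, pow_one, zero_add]
  | succ m ih =>
    rw [pow_succ] at hm ⊢
    have hle : B ^ (m + 1) ≤ B ^ (m + 1) * B := le_mul_of_one_mem h1
    have h := ih fun h => hm (top_le_iff.1 (h ▸ hle))
    have hne : B ^ (m + 1) ≠ ⊥ := by
      refine (Submodule.ne_bot_iff _).2 ⟨1, ?_, one_ne_zero⟩
      simpa using Submodule.pow_mem_pow B h1 (m + 1)
    have := two_mul_finrank_add_finrank_le h1 hgen hne hm
    linarith

theorem exists_isLeast_pow_eq_top {B : Submodule K L} (h1 : (1 : L) ∈ B)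
    (hgen : Algebra.adjoin K (B : Set L) = ⊤) :
    ∃ n : ℕ, IsLeast {m : ℕ | 1 ≤ m ∧ B ^ m = ⊤} n ∧ n * finrank K B ≤ 2 * finrank K L := by
  have hB : 0 < finrank K B := by
    refine Nat.pos_of_ne_zero fun h => one_ne_zero (α := L) ?_
    rwa [Submodule.finrank_eq_zero.1 h, Submodule.mem_bot] at h1
  have key : ∀ m : ℕ, B ^ (m + 1) ≠ ⊤ → (m + 2) * finrank K B ≤ 2 * finrank K L := fun m hm =>
    (succ_mul_finrank_le_of_pow_ne_top h1 hgen m hm).trans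
      (Nat.mul_le_mul_left 2 (Submodule.finrank_le _))
  have hne : {m : ℕ | 1 ≤ m ∧ B ^ m = ⊤}.Nonempty := by
    refine ⟨2 * finrank K L + 1, by omega, ?_⟩
    by_contra h
    have := key _ h
    nlinarith
  have hleast := isLeast_csInf hne
  refine ⟨_, hleast, ?_⟩
  obtain ⟨hn1, -⟩ := hleast.1
  generalize sInf {m : ℕ | 1 ≤ m ∧ B ^ m = ⊤} = n at *
  obtain _ | _ | n := n
  · omega
  · have := Submodule.finrank_le B
    omega
  -- By minimality the preceding power is proper, and `key` gains one in the exponent.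
  · refine key n fun h => ?_
    have := hleast.2 ⟨by omega, h⟩
    omega

/-! ### Reduction to the field generated by `B` -/

omit [FiniteDimensional K L] in
theorem isFieldSubspace_pow_iff {B : Submodule K L} (h1 : (1 : L) ∈ B) {n : ℕ} (hn : 1 ≤ n) :
    IsFieldSubspace (B ^ n) ↔
      B ^ n = Subalgebra.toSubmodule (Algebra.adjoin K (B : Set L)) := by
  have hle : B ^ n ≤ Subalgebra.toSubmodule (Algebra.adjoin K (B : Set L)) := by
    clear hn
    induction n with
    | zero =>
      rw [pow_zero, Submodule.one_le]
      exact one_mem (Algebra.adjoin K (B : Set L))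
    | succ n ih =>
      rw [pow_succ, Submodule.mul_le]
      exact fun x hx y hy => mul_mem (S := Subalgebra K L) (ih hx) (Algebra.subset_adjoin hy)
  constructor
  · rintro ⟨F, hF⟩
    have hF' : ∀ x, x ∈ F ↔ x ∈ B ^ n := fun x => Set.ext_iff.1 hF x
    refine le_antisymm hle fun x hx => (hF' x).1 ?_
    have hBF : B ≤ B ^ n := by
      obtain ⟨n, rfl⟩ := Nat.exists_eq_add_of_le' hn
      rw [pow_succ']
      refine le_mul_of_one_mem ?_
      simpa using Submodule.pow_mem_pow B h1 n
    replace hx : x ∈ Algebra.adjoin K (B : Set L) := hx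
    induction hx using Algebra.adjoin_induction with
    | mem b hb => exact (hF' b).2 (hBF hb)
    | algebraMap r =>
      rw [hF', Algebra.algebraMap_eq_smul_one]
      exact (B ^ n).smul_mem r (hBF h1)
    | add u v _ _ hu hv => exact F.add_mem hu hv
    | mul u v _ _ hu hv => exact F.mul_mem hu hv
  · intro h
    refine ⟨(IntermediateField.adjoin K (B : Set L)).toSubfield, ?_⟩
    rw [h]
    change ((IntermediateField.adjoin K (B : Set L)).toSubalgebra : Set L) = _
    rw [IntermediateField.adjoin_toSubalgebra_of_isAlgebraic
      (fun x _ => Algebra.IsAlgebraic.isAlgebraic x)]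
    rfl

theorem exists_isFieldExponent_mul_finrank_le {B : Submodule K L} (h1 : (1 : L) ∈ B) :
    ∃ n : ℕ, IsFieldExponent B n ∧ n * finrank K B ≤ 2 * finrank K L := by
  let M := IntermediateField.adjoin K (B : Set L)
  have hM : M.toSubalgebra = Algebra.adjoin K (B : Set L) :=
    IntermediateField.adjoin_toSubalgebra_of_isAlgebraic
      (fun x _ => Algebra.IsAlgebraic.isAlgebraic x)
  let ι : M →ₐ[K] L := M.val
  have hι : Function.Injective ι.toLinearMap := ι.toRingHom.injective
  let C : Submodule K M := B.comap ι.toLinearMap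
  have hCB : C.map ι.toLinearMap = B := by
    refine Submodule.map_comap_eq_of_le fun b hb => ?_
    exact ⟨⟨b, IntermediateField.subset_adjoin K _ hb⟩, rfl⟩
  have hfin : finrank K C = finrank K B :=
    (LinearEquiv.finrank_eq (Submodule.equivMapOfInjective _ hι C)).trans (by rw [hCB])
  have hrange : (⊤ : Submodule K M).map ι.toLinearMap =
      Subalgebra.toSubmodule (Algebra.adjoin K (B : Set L)) := by
    rw [← hM]
    ext x
    simp [ι]
  have hpow : ∀ n, (C ^ n).map ι.toLinearMap = B ^ n := fun n => by
    rw [Submodule.map_pow, hCB]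
  have hgen : Algebra.adjoin K (C : Set M) = ⊤ := by
    refine Subalgebra.map_injective (f := ι) ι.toRingHom.injective ?_
    rw [AlgHom.map_adjoin]
    have : (ι '' (C : Set M)) = (B : Set L) := congrArg SetLike.coe hCB
    rw [this, Algebra.map_top, ← hM]
    exact M.range_val.symm
  obtain ⟨n, hn, hle⟩ := exists_isLeast_pow_eq_top (B := C) (by simpa [C] using h1) hgen
  refine ⟨n, ?_, ?_⟩
  · rw [IsFieldExponent]
    convert hn using 2
    ext m
    refine and_congr_right fun hm => ?_
    rw [spanPow_eq_pow, isFieldSubspace_pow_iff h1 hm, ← hpow, ← hrange]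
    exact (Submodule.map_injective_of_injective hι).eq_iff
  · rw [← hfin]
    exact hle.trans (Nat.mul_le_mul_left 2 M.toSubmodule.finrank_le)

/-! ### Sharpness in codimension one -/

theorem finrank_dvd_of_isFieldSubspace {B : Submodule K L} (h : IsFieldSubspace B) :
    finrank K B ∣ finrank K L := by
  obtain ⟨F, hF⟩ := h
  have hF' : ∀ x, x ∈ F ↔ x ∈ B := fun x => Set.ext_iff.1 hF x
  let M : IntermediateField K L := F.toIntermediateField fun r => by
    rw [hF', Algebra.algebraMap_eq_smul_one]
    exact B.smul_mem r ((hF' 1).1 F.one_mem)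
  have hM : Subalgebra.toSubmodule M.toSubalgebra = B := Submodule.ext hF'
  rw [← hM]
  exact ⟨_, (finrank_mul_finrank K M L).symm⟩

theorem isFieldExponent_two_of_finrank_add_one {B : Submodule K L} (hL : 4 ≤ finrank K L)
    (hB : finrank K B + 1 = finrank K L) : IsFieldExponent B 2 := by
  refine ⟨⟨by norm_num, ?_⟩, fun m ⟨hm1, hm⟩ => ?_⟩
  -- Otherwise the dual `Y` is nonzero with `dim (Y * B) ≤ 1`, yet `Y * B` contains a multiple of
  -- `B`.
  · have htop : B * B = ⊤ := by
      by_contra h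
      obtain ⟨Y, hY, hYB⟩ := exists_dual_subspace B B
      have hlt := Submodule.finrank_lt h
      have hY0 : Y ≠ ⊥ := by
        rintro rfl
        rw [finrank_bot] at hY
        omega
      obtain ⟨y, hy, hy0⟩ := Submodule.exists_mem_ne_zero_of_ne_bot hY0
      have : finrank K B ≤ finrank K ↥(Y * B) := by
        rw [← finrank_map_mulLeft hy0 B]
        refine Submodule.finrank_mono ?_
        rintro _ ⟨c, hc, rfl⟩
        exact Submodule.mul_mem_mul hy hc
      omega
    rw [spanPow_eq_pow, pow_two, htop]
    exact ⟨⊤, rfl⟩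
  -- `B` itself is no field: `dim L - 1` does not divide `dim L`.
  · by_contra hlt
    obtain rfl : m = 1 := by omega
    rw [spanPow_eq_pow, pow_one] at hm
    have hdvd := finrank_dvd_of_isFieldSubspace hm
    rw [← hB, Nat.dvd_add_right dvd_rfl] at hdvd
    have := Nat.le_of_dvd one_pos hdvd
    omega

theorem floor_two_mul_div_eq_two {N d : ℕ} (hN : 4 ≤ N) (hd : d + 1 = N) :
    ⌊2 * (N : ℚ) / (d : ℚ)⌋₊ = 2 := by
  subst hd
  have hd : (3 : ℚ) ≤ d := by exact_mod_cast (by omega : 3 ≤ d)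
  rw [Nat.floor_eq_iff (by positivity), le_div_iff₀ (by linarith), div_lt_iff₀ (by linarith)]
  push_cast
  constructor <;> linarith

end Isoperimetric

theorem mainTheorem7 {K L : Type*} [Field K] [Field L] [Algebra K L]
    [FiniteDimensional K L] [Algebra.IsSeparable K L] :
    -- the bound
    (∀ B : Submodule K L, (1 : L) ∈ B →
      ∃ n : ℕ, IsFieldExponent B n ∧
        (n : ℚ) ≤ 2 * (Module.finrank K L : ℚ) / (Module.finrank K B : ℚ) ∧
        n ≤ ⌊2 * (Module.finrank K L : ℚ) / (Module.finrank K B : ℚ)⌋₊) ∧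
    -- sharpness
    (4 ≤ Module.finrank K L →
      (∃ B : Submodule K L, (1 : L) ∈ B ∧
        IsFieldExponent B
          ⌊2 * (Module.finrank K L : ℚ) / (Module.finrank K B : ℚ)⌋₊) ∧
      (∀ B : Submodule K L, Module.finrank K B + 1 = Module.finrank K L →
        IsFieldExponent B
          ⌊2 * (Module.finrank K L : ℚ) / (Module.finrank K B : ℚ)⌋₊)) := by
  refine ⟨fun B h1 => ?_, fun hL => ?_⟩
  · obtain ⟨n, hn, hle⟩ := exists_isFieldExponent_mul_finrank_le h1
    have hB : 0 < Module.finrank K B := by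
      refine Nat.pos_of_ne_zero fun h => one_ne_zero (α := L) ?_
      rwa [Submodule.finrank_eq_zero.1 h, Submodule.mem_bot] at h1
    have hq : (n : ℚ) ≤ 2 * (Module.finrank K L : ℚ) / (Module.finrank K B : ℚ) := by
      rw [le_div_iff₀ (by exact_mod_cast hB)]
      exact_mod_cast hle
    exact ⟨n, hn, hq, Nat.le_floor hq⟩
  · have hall : ∀ B : Submodule K L, Module.finrank K B + 1 = Module.finrank K L →
        IsFieldExponent B
          ⌊2 * (Module.finrank K L : ℚ) / (Module.finrank K B : ℚ)⌋₊ := fun B hB => by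
      rw [floor_two_mul_div_eq_two hL hB]
      exact isFieldExponent_two_of_finrank_add_one hL hB
    obtain ⟨B, h1, hB⟩ := exists_one_mem_finrank_add_one (K := K) hL
    exact ⟨⟨B, h1, hall B hB⟩, hall⟩
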